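/- Let $\mathcal H$ and $\mathcal H_i$ ($i\in N$, $N$ a finite set of shares) be finite-dimensional complex Hilbert spaces, $\mathcal H\neq 0$, and write $\mathcal H_X=\bigotimes_{i\in X}\mathcal H_i$ for $X\subseteq N$. A quantum operation is a completely positive trace-preserving map. A quantum operation $\mathcal E$ with input space $\mathcal H$ is *reversible* if there is a quantum operation $\mathcal R$ with $\mathcal R(\mathcal E(\rho))=\rho$ for all density operators $\rho$ on $\mathcal H$, and *vanishing* if there is a density operator $\rho_0$ with $\mathcal E(\rho)=\rho_0$ for all density operators $\rho$ on $\mathcal H$. A QSS scheme on $N$ is a reversible quantum operation $W_N$ from operators on $\mathcal H$ to operators on $\mathcal H_N$. It is a pure-state scheme if it sends pure states to pure states, and a mixed-state scheme otherwise. A set $X\subseteq N$ is *qualified* (resp. *forbidden*) for $W_N$ if $W_X=\mathrm{Tr}_{N\setminus X}\circ W_N$ is reversible (resp. vanishing), and *intermediate* if it is neither. The access structure of $W_N$ is the list of its forbidden, intermediate and qualified sets. Let $W_N$ be a mixed-state QSS scheme, let $Z$ be an additional share, and put $N'=N\cup\{Z\}$. 1. There are a finite-dimensional Hilbert space $\mathcal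 H_Z$ and an isometry $V:\mathcal H\to\mathcal H_N\otimes\mathcal H_Z$ such that $W_{N'}(\rho)=V\rho V^*$ is a pure-state QSS scheme on $N'$ and $W_N=\mathrm{Tr}_Z\circ W_{N'}$; that is, $W_N$ is realized by discarding the share $Z$ from $W_{N'}$. 2. For every finite-dimensional Hilbert space $\mathcal H_Z$ and every pure-state QSS scheme $W_{N'}$ on $N'$ with $W_N=\mathrm{Tr}_Z\circ W_{N'}$, the access structure of $W_{N'}$ is uniquely determined by that of $W_N$: there is a map $F$, depending only on the set $N$, from access structures on $N$ to access structures on $N'$ that sends the access structure of $W_N$ to that of $W_{N'}$, for all such $W_N$ and $W_{N'}$. Explicitly, a set $X\subseteq N$ is qualified (resp. forbidden, intermediate) for $W_{N'}$ if and only if it is so for $W_N$; and a set $Y\subseteq N'$ with $Z\in Y$ is qualified (resp. forbidden, intermediate) for $W_{N'}$ if and only if $N'\setminus Y$ is forbidden (resp. qualified, intermediate) for $W_{N'}$. -/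

import Mathlib

open scoped Matrix ComplexOrder

noncomputable section

namespace QSS

section Channels

variable {a b c : Type*} [Fintype a] [DecidableEq a] [Fintype b] [DecidableEq b]

/-- Density operators on the Hilbert space `ℂ^a`. -/
def IsDensity (ρ : Matrix a a ℂ) : Prop :=
  ρ.PosSemidef ∧ ρ.trace = 1

/-- Pure states: the rank one projections `|ψ⟩⟨ψ|` with `ψ` a unit vector. -/
def IsPureState (ρ : Matrix a a ℂ) : Prop :=
  ∃ ψ : a → ℂ, star ψ ⬝ᵥ ψ = 1 ∧ ρ = Matrix.vecMulVec ψ (star ψ)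

/-- The map `id_k ⊗ E` on `k × k` block matrices with blocks in `L(ℂ^a)`. -/
def ampliation (k : ℕ) (E : Matrix a a ℂ →ₗ[ℂ] Matrix b b ℂ)
    (M : Matrix (Fin k × a) (Fin k × a) ℂ) : Matrix (Fin k × b) (Fin k × b) ℂ :=
  Matrix.of fun p q => E (Matrix.of fun i j => M (p.1, i) (q.1, j)) p.2 q.2

/-- Quantum operations: completely positive and trace preserving maps. -/
structure IsQuantumOperation (E : Matrix a a ℂ →ₗ[ℂ] Matrix b b ℂ) : Prop where
  completelyPositive : ∀ (k : ℕ) (M : Matrix (Fin k × a) (Fin k × a) ℂ),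
    M.PosSemidef → (ampliation k E M).PosSemidef
  tracePreserving : ∀ M : Matrix a a ℂ, (E M).trace = M.trace

/-- `E` is reversible with respect to the set `S` of states. -/
def IsReversible (E : Matrix a a ℂ →ₗ[ℂ] Matrix b b ℂ) (S : Set (Matrix a a ℂ)) : Prop :=
  ∃ R : Matrix b b ℂ →ₗ[ℂ] Matrix a a ℂ, IsQuantumOperation R ∧ ∀ ρ ∈ S, R (E ρ) = ρ

/-- `E` is vanishing with respect to the set `S` of states. -/
def IsVanishing (E : Matrix a a ℂ →ₗ[ℂ] Matrix b b ℂ) (S : Set (Matrix a a ℂ)) : Prop :=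
  ∃ ρ₀ : Matrix b b ℂ, IsDensity ρ₀ ∧ ∀ ρ ∈ S, E ρ = ρ₀

/-- Pure state channels send pure states to pure states. -/
def IsPureStateChannel (E : Matrix a a ℂ →ₗ[ℂ] Matrix b b ℂ) : Prop :=
  ∀ ρ : Matrix a a ℂ, IsPureState ρ → IsPureState (E ρ)

/-- The map `ρ ↦ V ρ V*`. -/
def conjMap (V : Matrix b a ℂ) : Matrix a a ℂ →ₗ[ℂ] Matrix b b ℂ where
  toFun ρ := V * ρ * Vᴴ
  map_add' ρ σ := by rw [Matrix.mul_add, Matrix.add_mul]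
  map_smul' t ρ := by simp

/-- With respect to an identification `e : c ≃ a × b` of basis labels (that is, `ℂ^c` is
identified with `ℂ^a ⊗ ℂ^b`), the partial trace over the second tensor factor `ℂ^b`. -/
def partialTrace (e : c ≃ a × b) : Matrix c c ℂ →ₗ[ℂ] Matrix a a ℂ where
  toFun M := Matrix.of fun i j => ∑ k : b, M (e.symm (i, k)) (e.symm (j, k))
  map_add' M M' := by
    ext i j
    simp [Finset.sum_add_distrib]
  map_smul' t M := by
    ext i j
    simp [Finset.mul_sum]

end Channels

section Shares

variable {ι : Type*} [Fintype ι] [DecidableEq ι]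

/-- Labels of the product basis of `H_N = ⨂ i, H_i`, where the share `H_i` is `ℂ^(d i)`. -/
abbrev Label (d : ι → ℕ) : Type _ := ∀ i, Fin (d i)

/-- Labels of the product basis of `H_X = ⨂ i ∈ X, H_i`. -/
abbrev SubLabel (d : ι → ℕ) (X : Finset ι) : Type _ := ∀ i : {i // i ∈ X}, Fin (d i)

/-- An encoder from operators on `H = ℂ^h` to operators on `H_N`. -/
abbrev Encoder (h : ℕ) (d : ι → ℕ) : Type _ :=
  Matrix (Fin h) (Fin h) ℂ →ₗ[ℂ] Matrix (Label d) (Label d) ℂ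

/-- The restricted encoder `W_X = Tr_{N \ X} ∘ W_N`. -/
def restrict {h : ℕ} {d : ι → ℕ} (W : Encoder h d) (X : Finset ι) :
    Matrix (Fin h) (Fin h) ℂ →ₗ[ℂ] Matrix (SubLabel d X) (SubLabel d X) ℂ :=
  (partialTrace (Equiv.piEquivPiSubtypeProd (fun i => i ∈ X) (fun i => Fin (d i)))).comp W

/-- A quantum secret sharing scheme: a quantum operation that is reversible with respect to
all the states of `H`. -/
def IsScheme {h : ℕ} {d : ι → ℕ} (W : Encoder h d) : Prop :=
  IsQuantumOperation W ∧ IsReversible W {ρ | IsDensity ρ}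

/-- Pure state schemes. -/
def IsPureScheme {h : ℕ} {d : ι → ℕ} (W : Encoder h d) : Prop :=
  IsScheme W ∧ IsPureStateChannel W

/-- Mixed state schemes: the schemes that are not pure state schemes. -/
def IsMixedScheme {h : ℕ} {d : ι → ℕ} (W : Encoder h d) : Prop :=
  IsScheme W ∧ ¬ IsPureStateChannel W

/-- `X` is qualified. -/
def IsQualified {h : ℕ} {d : ι → ℕ} (W : Encoder h d) (X : Finset ι) : Prop :=
  IsReversible (restrict W X) {ρ | IsDensity ρ}

/-- `X` is forbidden. -/
def IsForbidden {h : ℕ} {d : ι → ℕ} (W : Encoder h d) (X : Finset ι) : Prop :=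
  IsVanishing (restrict W X) {ρ | IsDensity ρ}

/-- `X` is intermediate: neither qualified nor forbidden. -/
def IsIntermediate {h : ℕ} {d : ι → ℕ} (W : Encoder h d) (X : Finset ι) : Prop :=
  ¬ IsQualified W X ∧ ¬ IsForbidden W X

/-- An access structure on the set `ι` of shares: the list of the forbidden, intermediate and
qualified sets. For `2 ≤ h` the three properties partition the sets of shares, so this is a map
from sets of shares to three labels; for `h = 1` every set is both forbidden and qualified. -/
structure AccessStructure (ι : Type*) where
  forbidden : Set (Finset ι)
  intermediate : Set (Finset ι)
  qualified : Set (Finset ι)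

/-- The access structure of an encoder. -/
def accessStructure {h : ℕ} {d : ι → ℕ} (W : Encoder h d) : AccessStructure ι where
  forbidden := {X | IsForbidden W X}
  intermediate := {X | IsIntermediate W X}
  qualified := {X | IsQualified W X}

/-- The dimensions of the shares `N' = N ∪ {Z}`, where `Z` is the share `none : Option ι`, of
dimension `z`. -/
def addShare (d : ι → ℕ) (z : ℕ) : Option ι → ℕ
  | none => z
  | some i => d i

/-- The identification `H_{N'} = H_N ⊗ H_Z` on labels of the product basis. -/
def splitShare (d : ι → ℕ) (z : ℕ) : Label (addShare d z) ≃ Label d × Fin z where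
  toFun f := (fun i => f (some i), f none)
  invFun q o := match o with
    | none => q.2
    | some i => q.1 i
  left_inv f := by
    funext o
    cases o <;> rfl
  right_inv _ := rfl

/-- Discarding the share `Z = none`: the encoder `Tr_Z ∘ W_{N'}`, with values in operators
on `H_N`. -/
def discardShare {h : ℕ} {d : ι → ℕ} {z : ℕ} (W : Encoder h (addShare d z)) : Encoder h d :=
  (partialTrace (splitShare d z)).comp W

end Shares

end QSS

end

open Matrix

namespace QSS

set_option linter.unusedSectionVars false

/-! ### Kraus decompositions and necessity of the Knill–Laflamme condition -/

section Kraus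

variable {a b c κ : Type*} [Fintype a] [DecidableEq a] [Fintype b] [DecidableEq b]
  [Fintype c] [DecidableEq c] [Fintype κ]

/-! Realization is Stinespring's dilation: stack the Kraus operators of `W` into one isometry `V`,
with the Kraus index as the basis label of `Z`.

The access structure rests on complementarity. A pure-state scheme is conjugation by an isometry `V`
(`exists_isometry_of_isPureStateChannel`). Tracing out a factor leaves the Kraus operators `K i`,
the slices of `V` along that factor. Keeping the other factor is reversible iff every `(K i)ᴴ * K j`
is a scalar (Knill–Laflamme). But the entries of these products are exactly those of the
complementary channel on matrix units, so the same condition says that the complementary channel is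
`M ↦ tr(M) ρ₀`, that is, vanishing (`isReversible_iff_isVanishing`). Hence a set is qualified iff
its complement is forbidden.

A set avoiding `Z` has the same restricted encoder in `W'` as in `W`, up to relabelling
(`restrict_map_some`). If a set contains `Z`, its complement avoids `Z`, and complementarity decides
its type. -/

@[simp]
theorem conjMap_apply (V : Matrix b a ℂ) (ρ : Matrix a a ℂ) : conjMap V ρ = V * ρ * Vᴴ := rfl

theorem conjMap_single_apply (V : Matrix b a ℂ) (i j : a) (s t : b) :
    conjMap V (single i j 1) s t = V s i * star (V t j) := by
  simp [Matrix.mul_apply, single, ite_and]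

theorem ampliation_conjMap (k : ℕ) (V : Matrix b a ℂ) (M : Matrix (Fin k × a) (Fin k × a) ℂ) :
    ampliation k (conjMap V) M =
      kroneckerMap (· * ·) (1 : Matrix (Fin k) (Fin k) ℂ) V * M *
        (kroneckerMap (· * ·) (1 : Matrix (Fin k) (Fin k) ℂ) V)ᴴ := by
  ext ⟨p, s⟩ ⟨q, t⟩
  simp [ampliation, Matrix.mul_apply, Fintype.sum_prod_type, Matrix.one_apply, ite_mul,
    apply_ite]

theorem isQuantumOperation_kraus {K : κ → Matrix b a ℂ} (hK : ∑ i, (K i)ᴴ * K i = 1) :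
    IsQuantumOperation (∑ i, conjMap (K i)) where
  completelyPositive k M hM := by
    have : ampliation k (∑ i, conjMap (K i)) M = ∑ i, ampliation k (conjMap (K i)) M := by
      ext p q
      simp [ampliation, Matrix.sum_apply, LinearMap.sum_apply]
    rw [this]
    refine posSemidef_sum _ fun i _ => ?_
    rw [ampliation_conjMap]
    exact hM.mul_mul_conjTranspose_same _
  tracePreserving M := by
    have : ∀ i, (K i * M * (K i)ᴴ).trace = ((K i)ᴴ * K i * M).trace := fun i => by
      rw [Matrix.trace_mul_comm, Matrix.mul_assoc]
    simp only [LinearMap.sum_apply, conjMap_apply, trace_sum, this]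
    rw [← trace_sum, ← Finset.sum_mul, hK, Matrix.one_mul]

theorem ext_single {E F : Matrix a a ℂ →ₗ[ℂ] Matrix b b ℂ}
    (h : ∀ i j, E (single i j 1) = F (single i j 1)) : E = F := by
  refine LinearMap.ext fun M => ?_
  rw [matrix_eq_sum_single M]
  simp only [map_sum]
  refine Finset.sum_congr rfl fun i _ => Finset.sum_congr rfl fun j _ => ?_
  have : single i j (M i j) = M i j • single i j (1 : ℂ) := by simp
  rw [this, map_smul, map_smul, h]

/-- Choi's theorem: a quantum operation has a Kraus decomposition. -/
theorem IsQuantumOperation.exists_kraus {E : Matrix a a ℂ →ₗ[ℂ] Matrix b b ℂ}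
    (hE : IsQuantumOperation E) :
    ∃ (n : ℕ) (K : Fin n → Matrix b a ℂ),
      E = ∑ i, conjMap (K i) ∧ ∑ i, (K i)ᴴ * K i = 1 := by
  let e := Fintype.equivFin a
  -- The unnormalized maximally entangled vector; the ampliation of its projection is the Choi
  -- matrix, whose blocks are the values of `E` on matrix units.
  let v : Fin (Fintype.card a) × a → ℂ := fun p => if e p.2 = p.1 then 1 else 0
  have hC := hE.completelyPositive _ _ (posSemidef_vecMulVec_self_star v)
  obtain ⟨B, hB⟩ : ∃ B : Matrix (Fin (Fintype.card a) × b) (Fin (Fintype.card a) × b) ℂ,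
      ampliation _ E (vecMulVec v (star v)) = Bᴴ * B := by
    open scoped MatrixOrder in
    exact CStarAlgebra.nonneg_iff_eq_star_mul_self.mp hC.nonneg
  have hE' : ∀ i j s t, E (single i j 1) s t = ∑ r, star (B r (e i, s)) * B r (e j, t) := by
    intro i j s t
    have h := congrFun (congrFun hB (e i, s)) (e j, t)
    rw [Matrix.mul_apply] at h
    simp only [conjTranspose_apply] at h
    rw [← h]
    simp only [ampliation, Matrix.of_apply]
    refine congrFun (congrFun (congrArg E ?_) s) t
    ext x y
    simp [v, vecMulVec_apply, single, ← ite_and, eq_comm, and_comm]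
  let f := Fintype.equivFin (Fin (Fintype.card a) × b)
  -- Each row of the factor `B`, conjugated and reshaped, is one Kraus operator.
  let K : Fin (Fintype.card (Fin (Fintype.card a) × b)) → Matrix b a ℂ :=
    fun m => Matrix.of fun s i => star (B (f.symm m) (e i, s))
  have hK : ∀ i j s t, E (single i j 1) s t = ∑ m, K m s i * star (K m t j) := by
    intro i j s t
    rw [hE', ← f.symm.sum_comp]
    simp [K]
  refine ⟨_, K, ext_single fun i j => ?_, ?_⟩
  · ext s t
    rw [hK, LinearMap.sum_apply, Matrix.sum_apply]
    simp only [conjMap_single_apply]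
  · ext j i
    have h := hE.tracePreserving (single i j 1)
    simp only [trace, diag_apply, hK] at h
    rw [Finset.sum_comm] at h
    simp only [Matrix.sum_apply, Matrix.mul_apply, conjTranspose_apply]
    simp only [mul_comm (star _)]
    rw [h]
    simp [single, Matrix.one_apply, ite_and]

theorem IsPureState.isDensity {ρ : Matrix a a ℂ} (h : IsPureState ρ) : IsDensity ρ := by
  obtain ⟨ψ, hψ, rfl⟩ := h
  refine ⟨posSemidef_vecMulVec_self_star ψ, ?_⟩
  rw [trace_vecMulVec, dotProduct_comm, hψ]

theorem isPureState_single (i : a) : IsPureState (single i i (1 : ℂ)) := by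
  refine ⟨Pi.single i 1, by simp, ?_⟩
  ext x y
  simp [vecMulVec_apply, single, Pi.single_apply, ← ite_and, eq_comm, and_comm]

/-- Pure states span the space of operators. -/
theorem ext_isPureState {E F : Matrix a a ℂ →ₗ[ℂ] Matrix b b ℂ}
    (h : ∀ ρ, IsPureState ρ → E ρ = F ρ) : E = F := by
  have hrank : ∀ ψ : a → ℂ, E (vecMulVec ψ (star ψ)) = F (vecMulVec ψ (star ψ)) := by
    intro ψ
    by_cases hψ : ψ = 0
    · simp [hψ]
    have hpos : 0 < star ψ ⬝ᵥ ψ := dotProduct_star_self_pos_iff.mpr hψ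
    obtain ⟨r, hr⟩ : ∃ r : ℝ, (r : ℂ) = star ψ ⬝ᵥ ψ :=
      ⟨_, (Complex.eq_re_of_ofReal_le hpos.le).symm⟩
    have hr0 : 0 < r := by rw [← hr] at hpos; exact_mod_cast hpos
    have hs : ((Real.sqrt r : ℝ) : ℂ) * (Real.sqrt r : ℝ) = r := by
      rw [← Complex.ofReal_mul, Real.mul_self_sqrt hr0.le]
    have hs0 : ((Real.sqrt r : ℝ) : ℂ) ≠ 0 := by
      exact_mod_cast (Real.sqrt_pos.mpr hr0).ne'
    set t : ℂ := ((Real.sqrt r : ℝ) : ℂ) with ht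
    have hst : star t = t := Complex.conj_ofReal _
    have hψ' : vecMulVec ψ (star ψ) =
        (t * t) • vecMulVec (t⁻¹ • ψ) (star (t⁻¹ • ψ)) := by
      rw [star_smul, star_inv₀, hst, smul_vecMulVec, vecMulVec_smul, smul_smul, smul_smul]
      field_simp
      simp
    rw [hψ', map_smul, map_smul, h _ ⟨t⁻¹ • ψ, ?_, rfl⟩]
    rw [star_smul, star_inv₀, hst, smul_dotProduct, dotProduct_smul, ← hr, ← hs]
    simp only [smul_eq_mul]
    field_simp
  refine ext_single fun i j => ?_
  -- Polarization writes a matrix unit through four rank one projections.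
  have hpol : single i j (1 : ℂ) = (1 / 4 : ℂ) •
      (vecMulVec (Pi.single i 1 + Pi.single j 1) (star (Pi.single i 1 + Pi.single j 1 : a → ℂ))
      - vecMulVec (Pi.single i 1 - Pi.single j 1) (star (Pi.single i 1 - Pi.single j 1 : a → ℂ))
      + Complex.I • vecMulVec (Pi.single i 1 + Complex.I • Pi.single j 1)
        (star (Pi.single i 1 + Complex.I • Pi.single j 1 : a → ℂ))
      - Complex.I • vecMulVec (Pi.single i 1 - Complex.I • Pi.single j 1)
        (star (Pi.single i 1 - Complex.I • Pi.single j 1 : a → ℂ))) := by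
    have hs : single i j (1 : ℂ) = vecMulVec (Pi.single i 1) (star (Pi.single j 1)) := by
      ext x y
      simp [vecMulVec_apply, single, Pi.single_apply, ← ite_and, eq_comm, and_comm]
    rw [hs]
    generalize (Pi.single i 1 : a → ℂ) = u
    generalize (Pi.single j 1 : a → ℂ) = w
    ext x y
    simp [vecMulVec_apply]
    linear_combination (1 / 2 * u x * starRingEnd ℂ (w y) - 1 / 2 * w x * starRingEnd ℂ (u y)) *
      Complex.I_sq
  rw [hpol]
  simp only [map_smul, map_add, map_sub, hrank]

/-- Kraus operators of the identity are scalars. -/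
theorem exists_eq_smul_one_of_kraus_id {L : κ → Matrix a a ℂ}
    (hL : ∑ i, conjMap (L i) = LinearMap.id) (m : κ) : ∃ t : ℂ, L m = t • 1 := by
  -- Each matrix position gives a vector indexed by `m`; these are their inner products.
  -- Off-diagonal positions have norm zero, and two diagonal ones differ by squared norm `1 - 1 - 1
  -- + 1 = 0`.
  have hS : ∀ p q i j, ∑ m, L m p i * star (L m q j) = if p = i ∧ q = j then 1 else 0 := by
    intro p q i j
    have h := congrFun (congrFun (LinearMap.congr_fun hL (single i j 1)) p) q
    rw [LinearMap.sum_apply, Matrix.sum_apply] at h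
    simp only [conjMap_single_apply] at h
    rw [h]
    simp [single, eq_comm]
  have hz : ∀ f : κ → ℂ, ∑ m, f m * star (f m) = 0 → ∀ m, f m = 0 := by
    intro f hf m
    exact congrFun (dotProduct_self_star_eq_zero.mp (show f ⬝ᵥ star f = 0 from hf)) m
  rcases isEmpty_or_nonempty a with ha | ⟨⟨x⟩⟩
  · exact ⟨0, Subsingleton.elim _ _⟩
  refine ⟨L m x x, ?_⟩
  ext p i
  by_cases hpi : p = i
  · subst hpi
    have := hz (fun m => L m p p - L m x x) (by
      simp only [star_sub, sub_mul, mul_sub, Finset.sum_sub_distrib, hS]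
      simp) m
    simpa [sub_eq_zero] using this
  · simpa [hpi] using hz (fun m => L m p i) (by rw [hS]; simpa using hpi) m

theorem conjMap_comp (V : Matrix c b ℂ) (U : Matrix b a ℂ) :
    (conjMap V).comp (conjMap U) = conjMap (V * U) := by
  ext1
  simp [Matrix.mul_assoc]

/-- The Knill–Laflamme condition is necessary for reversibility. -/
theorem IsReversible.knillLaflamme {K : κ → Matrix b a ℂ}
    (h : IsReversible (∑ i, conjMap (K i)) {ρ | IsDensity ρ}) :
    ∃ l : κ → κ → ℂ, ∀ i j, (K i)ᴴ * K j = l i j • 1 := by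
  obtain ⟨R, hR, hrec⟩ := h
  obtain ⟨n, T, rfl, hT⟩ := hR.exists_kraus
  -- The products `T m * K i` are Kraus operators of the identity, hence scalars; inserting `∑ (T
  -- m)ᴴ * T m = 1` into `(K i)ᴴ * K j` then gives a scalar.
  have hid : ∑ p : Fin n × κ, conjMap (T p.1 * K p.2) = LinearMap.id := by
    refine ext_isPureState fun ρ hρ => ?_
    rw [LinearMap.id_apply]
    conv_rhs => rw [← hrec ρ hρ.isDensity]
    simp only [Fintype.sum_prod_type, LinearMap.sum_apply, conjMap_apply, map_sum,
      conjTranspose_mul, Matrix.mul_assoc]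
    rw [Finset.sum_comm]
  choose t ht using exists_eq_smul_one_of_kraus_id hid
  refine ⟨fun i j => ∑ m, star (t (m, i)) * t (m, j), fun i j => ?_⟩
  have : ∀ m, (K i)ᴴ * ((T m)ᴴ * T m) * K j = (star (t (m, i)) * t (m, j)) • 1 := by
    intro m
    have h1 := ht (m, i)
    have h2 := ht (m, j)
    simp only at h1 h2
    calc _ = (T m * K i)ᴴ * (T m * K j) := by
          simp [Matrix.conjTranspose_mul, Matrix.mul_assoc]
      _ = _ := by rw [h1, h2]; simp [smul_smul, mul_comm]
  rw [Finset.sum_smul]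
  simp only [← this]
  rw [← Matrix.sum_mul, ← Matrix.mul_sum, hT, Matrix.mul_one]

end Kraus

/-! ### Sufficiency of the Knill–Laflamme condition, and the form of pure-state schemes -/

section KnillLaflamme

variable {a b c κ : Type*} [Fintype a] [DecidableEq a] [Fintype b] [DecidableEq b]
  [Fintype c] [DecidableEq c] [Fintype κ]

/-- Mixing the Kraus operators by a unitary matrix does not change the channel. -/
theorem sum_conjMap_unitary [DecidableEq κ] (K : κ → Matrix b a ℂ) {U : Matrix κ κ ℂ}
    (hU : U * Uᴴ = 1) :
    ∑ m, conjMap (∑ k, U k m • K k) = ∑ k, conjMap (K k) := by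
  refine ext_single fun i j => ?_
  ext s t
  simp only [LinearMap.sum_apply, Matrix.sum_apply, conjMap_single_apply, Matrix.smul_apply,
    smul_eq_mul, star_sum, star_mul']
  have hU' : ∀ k l, ∑ m, U k m * star (U l m) = if k = l then 1 else 0 := fun k l => by
    simpa [Matrix.mul_apply, Matrix.one_apply] using congrFun (congrFun hU k) l
  calc _ = ∑ k, ∑ l, (∑ m, U k m * star (U l m)) * (K k s i * star (K l t j)) := by
        simp only [Finset.sum_mul, Finset.mul_sum]
        rw [Finset.sum_comm]
        refine (Finset.sum_congr rfl fun k _ => Finset.sum_comm).trans ?_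
        rw [Finset.sum_comm]
        refine Finset.sum_congr rfl fun k _ => Finset.sum_congr rfl fun l _ =>
          Finset.sum_congr rfl fun m _ => ?_
        ring
    _ = _ := by
        simp only [hU']
        simp

theorem knillLaflamme_isHermitian [Nonempty a] {K : κ → Matrix b a ℂ} {l : Matrix κ κ ℂ}
    (h : ∀ i j, (K i)ᴴ * K j = l i j • 1) : l.IsHermitian := by
  obtain ⟨x⟩ := ‹Nonempty a›
  ext i j
  have h1 := congrArg conjTranspose (h j i)
  rw [conjTranspose_mul, conjTranspose_conjTranspose, h i j] at h1
  simpa using (congrFun (congrFun h1 x) x).symm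

/-- Reversal for Kraus operators that satisfy the Knill–Laflamme condition with a diagonal
matrix. -/
theorem isReversible_of_diagonal [DecidableEq κ] [Nonempty a] {F : κ → Matrix b a ℂ}
    (hF : ∑ i, (F i)ᴴ * F i = 1) {D : κ → ℝ}
    (hD : ∀ i j, (F i)ᴴ * F j = if i = j then (D i : ℂ) • 1 else 0) (S : Set (Matrix a a ℂ)) :
    IsReversible (∑ i, conjMap (F i)) S := by
  obtain ⟨x⟩ := ‹Nonempty a›
  have hD0 : ∀ i, 0 ≤ D i := by
    intro i
    have h1 : ((F i)ᴴ * F i) x x = D i := by simp [hD]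
    have h2 := (posSemidef_conjTranspose_mul_self (F i)).diag_nonneg (i := x)
    rw [h1] at h2
    exact_mod_cast h2
  have hDsum : ∑ i, (D i : ℂ) = 1 := by
    have h1 := congrFun (congrFun hF x) x
    simpa [hD, Matrix.sum_apply] using h1
  have hFD : ∀ i, D i = 0 → F i = 0 := fun i hi => by
    rw [← conjTranspose_mul_self_eq_zero, hD]
    simp [hi]
  -- Since `0⁻¹ = 0`, the indices with `D i = 0`, where `F i = 0`, drop out of the recovery.
  let r : κ → ℂ := fun i => ((Real.sqrt (D i) : ℝ) : ℂ)⁻¹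
  have hr : ∀ i, star (r i) = r i := fun i => by
    simp [r]
  have hDs : ∀ i, star (D i : ℂ) = D i := fun i => Complex.conj_ofReal _
  have hrr : ∀ i, r i * r i * D i = if D i = 0 then 0 else 1 := by
    intro i
    split_ifs with hi
    · simp [hi]
    · have h1 : ((Real.sqrt (D i) : ℝ) : ℂ) * (Real.sqrt (D i) : ℝ) = D i := by
        rw [← Complex.ofReal_mul, Real.mul_self_sqrt (hD0 i)]
      have h2 : (D i : ℂ) ≠ 0 := by exact_mod_cast hi
      simp only [r]
      rw [← mul_inv, h1, inv_mul_cancel₀ h2]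
  -- The nonzero `F i` are scaled isometries with mutually orthogonal ranges; `P` projects onto the
  -- sum of those ranges.
  let P : Matrix b b ℂ := ∑ i, (r i * r i) • (F i * (F i)ᴴ)
  have hPF : ∀ j, P * F j = F j := by
    intro j
    have h1 : ∀ i, (r i * r i) • (F i * (F i)ᴴ) * F j = if i = j then F j else 0 := by
      intro i
      rw [Matrix.smul_mul, Matrix.mul_assoc, hD]
      split_ifs with hij
      · subst hij
        rw [Matrix.mul_smul, Matrix.mul_one, smul_smul, hrr]
        split_ifs with h0
        · simp [hFD i h0]
        · simp
      · simp
    simp only [P, Matrix.sum_mul, h1]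
    simp
  have hPH : Pᴴ = P := by
    simp only [P, conjTranspose_sum, conjTranspose_smul, conjTranspose_mul,
      conjTranspose_conjTranspose, star_mul', hr]
  have hPP : P * P = P := by
    conv_lhs =>
      rhs
      simp only [P]
    simp only [Matrix.mul_sum, Matrix.mul_smul, ← Matrix.mul_assoc, hPF]
    rfl
  let Q : Matrix b b ℂ := 1 - P
  have hQH : Qᴴ = Q := by simp [Q, hPH]
  have hQQ : Qᴴ * Q = Q := by
    rw [hQH]
    simp [Q, Matrix.sub_mul, Matrix.mul_sub, hPP]
  -- Undo each `F i` on its range, and send the complement of all ranges to the fixed basis state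
  -- `x`; the second family only makes the recovery trace preserving.
  let T : κ ⊕ b → Matrix a b ℂ :=
    Sum.elim (fun i => r i • (F i)ᴴ) (fun y => vecMulVec (Pi.single x 1) (Q y))
  refine ⟨∑ i, conjMap (T i), isQuantumOperation_kraus ?_, fun ρ _ => ?_⟩
  · have h1 : ∀ y : b, (vecMulVec (Pi.single x 1 : a → ℂ) (Q y))ᴴ *
        vecMulVec (Pi.single x 1 : a → ℂ) (Q y) = vecMulVec (star (Q y)) (Q y) := by
      intro y
      rw [conjTranspose_vecMulVec, vecMulVec_mul_vecMulVec]
      simp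
    have h2 : ∑ y : b, vecMulVec (star (Q y)) (Q y) = Q := by
      conv_rhs => rw [← hQQ]
      ext s t
      simp [Matrix.sum_apply, vecMulVec_apply, Matrix.mul_apply]
    simp only [Fintype.sum_sum_type, T, Sum.elim_inl, Sum.elim_inr, h1, h2]
    simp only [conjTranspose_smul, conjTranspose_conjTranspose, hr, Matrix.smul_mul,
      Matrix.mul_smul, smul_smul]
    simp [Q, P]
  · have h1 : ∀ j y, vecMulVec (Pi.single x 1 : a → ℂ) (Q y) * F j = 0 := by
      intro j y
      have h3 : Q * F j = 0 := by simp [Q, Matrix.sub_mul, hPF]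
      rw [vecMulVec_mul]
      have : Q y ᵥ* F j = 0 := congrFun h3 y
      simp [this]
    have h2 : ∀ i j, conjMap (T (Sum.inl i)) (conjMap (F j) ρ) =
        if i = j then (D i : ℂ) • ρ else 0 := by
      intro i j
      rw [← LinearMap.comp_apply, conjMap_comp]
      simp only [T, Sum.elim_inl, Matrix.smul_mul, hD]
      split_ifs with hij
      · simp only [conjMap_apply, conjTranspose_smul, Matrix.smul_mul, Matrix.mul_smul,
          smul_smul, star_mul', hr, hDs, conjTranspose_one, Matrix.mul_one, Matrix.one_mul]
        congr 1
        have := hrr i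
        split_ifs at this with h0
        · simp [h0]
        · linear_combination (D i : ℂ) * this
      · simp
    have h3 : ∀ y j, conjMap (T (Sum.inr y)) (conjMap (F j) ρ) = 0 := by
      intro y j
      rw [← LinearMap.comp_apply, conjMap_comp]
      simp [T, h1]
    simp only [Fintype.sum_sum_type, LinearMap.add_apply, LinearMap.sum_apply, map_sum, h2, h3]
    simp only [Finset.sum_ite_eq', Finset.mem_univ, if_true, Finset.sum_const_zero, add_zero,
      ← Finset.sum_smul, hDsum, one_smul]

/-- The Knill–Laflamme condition is sufficient for reversibility. -/
theorem isReversible_of_knillLaflamme [Nonempty a] {K : κ → Matrix b a ℂ}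
    (hK : ∑ i, (K i)ᴴ * K i = 1) {l : κ → κ → ℂ} (h : ∀ i j, (K i)ᴴ * K j = l i j • 1)
    (S : Set (Matrix a a ℂ)) :
    IsReversible (∑ i, conjMap (K i)) S := by
  classical
  have hl : (Matrix.of l).IsHermitian := knillLaflamme_isHermitian (l := Matrix.of l) h
  -- Mixing the Kraus operators by `U` replaces `l` by `Uᴴ * l * U`, which is diagonal.
  let U : Matrix κ κ ℂ := hl.eigenvectorUnitary
  have hU : U * Uᴴ = 1 := Unitary.coe_mul_star_self hl.eigenvectorUnitary
  have hUl : Uᴴ * Matrix.of l * U = diagonal (fun i => (hl.eigenvalues i : ℂ)) := by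
    have hU' : Uᴴ * U = 1 := Unitary.coe_star_mul_self hl.eigenvectorUnitary
    have hsp : Matrix.of l = U * diagonal (fun i => (hl.eigenvalues i : ℂ)) * Uᴴ := by
      have h1 := hl.spectral_theorem
      rw [Unitary.conjStarAlgAut_apply] at h1
      exact h1
    conv_lhs => rw [hsp]
    simp only [← Matrix.mul_assoc, hU', Matrix.one_mul]
    rw [Matrix.mul_assoc, hU', Matrix.mul_one]
  let F : κ → Matrix b a ℂ := fun m => ∑ k, U k m • K k
  have hFF : ∀ i j, (F i)ᴴ * F j = (Uᴴ * Matrix.of l * U) i j • 1 := by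
    intro i j
    simp only [F, conjTranspose_sum, Matrix.sum_mul, Matrix.mul_sum, conjTranspose_smul,
      Matrix.smul_mul, Matrix.mul_smul, h, smul_smul, Matrix.mul_apply, Finset.sum_mul,
      Finset.sum_smul, Finset.smul_sum, conjTranspose_apply, Matrix.of_apply]
    refine Finset.sum_congr rfl fun k _ => Finset.sum_congr rfl fun m _ => ?_
    congr 1
    ring
  rw [← sum_conjMap_unitary K hU]
  refine isReversible_of_diagonal (D := hl.eigenvalues) ?_ (fun i j => ?_) S
  · refine Eq.trans ?_ hK
    have htr : (Uᴴ * Matrix.of l * U).trace = (Matrix.of l).trace := by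
      rw [Matrix.trace_mul_comm, ← Matrix.mul_assoc, hU, Matrix.one_mul]
    change ∑ i, (F i)ᴴ * F i = _
    simp only [hFF, h, ← Finset.sum_smul]
    congr 1
  · change (F i)ᴴ * F j = _
    rw [hFF, hUl, diagonal_apply]
    split_ifs <;> simp

/-- Vectors whose projections add up to a pure state are multiples of it. -/
theorem exists_eq_smul_of_sum_vecMulVec {v : κ → b → ℂ} {φ : b → ℂ} (hφ : star φ ⬝ᵥ φ = 1)
    (h : ∑ k, vecMulVec (v k) (star (v k)) = vecMulVec φ (star φ)) (k : κ) :
    ∃ t : ℂ, v k = t • φ := by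
  -- Evaluating both sides at `χ` gives `∑ |⟨χ, v k⟩|² = |⟨χ, φ⟩|² = 0`. It is then applied to the
  -- part of `v k` orthogonal to `φ`.
  have horth : ∀ χ : b → ℂ, star χ ⬝ᵥ φ = 0 → star χ ⬝ᵥ v k = 0 := by
    intro χ hχ
    have h1 := congrArg (fun M => star χ ⬝ᵥ M *ᵥ χ) h
    simp only [Matrix.sum_mulVec, dotProduct_sum, vecMulVec_mulVec] at h1
    have h2 : (fun k => star χ ⬝ᵥ v k) ⬝ᵥ star (fun k => star χ ⬝ᵥ v k) = 0 := by
      rw [dotProduct]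
      refine (Finset.sum_congr rfl fun k _ => ?_).trans (h1.trans ?_)
      · rw [Pi.star_apply, ← star_dotProduct]
        simp [mul_comm]
      · simp [hχ]
    exact congrFun (dotProduct_self_star_eq_zero.mp h2) k
  refine ⟨star φ ⬝ᵥ v k, ?_⟩
  have h1 : star (v k - (star φ ⬝ᵥ v k) • φ) ⬝ᵥ φ = 0 := by
    rw [star_sub, star_smul, sub_dotProduct, smul_dotProduct, hφ, star_dotProduct φ,
      star_star]
    simp
  have h2 := horth _ h1
  rw [← sub_eq_zero, ← dotProduct_star_self_eq_zero]
  conv_lhs => rw [dotProduct_sub, dotProduct_smul, h1, h2]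
  simp

/-- A pure state scheme is the conjugation by an isometry. -/
theorem exists_isometry_of_isPureStateChannel [Nonempty a] {E : Matrix a a ℂ →ₗ[ℂ] Matrix b b ℂ}
    (hE : IsQuantumOperation E) (hrev : IsReversible E {ρ | IsDensity ρ})
    (hpure : IsPureStateChannel E) :
    ∃ V : Matrix b a ℂ, Vᴴ * V = 1 ∧ E = conjMap V := by
  obtain ⟨n, K, rfl, hK⟩ := hE.exists_kraus
  obtain ⟨l, hl⟩ := hrev.knillLaflamme
  obtain ⟨m, hm⟩ : ∃ m, l m m ≠ 0 := by
    by_contra! hc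
    obtain ⟨x⟩ := ‹Nonempty a›
    have := congrFun (congrFun hK x) x
    simp [hl, hc] at this
  -- Purity makes the `i`-th columns of all Kraus operators parallel, but the ratio could depend on
  -- `i`, as for a constant channel. Knill–Laflamme excludes this: the difference `D` has columns
  -- both parallel and orthogonal to the nonzero columns of `K m`.
  have hprop : ∀ j, K j = (l m j / l m m) • K m := by
    intro j
    rw [← sub_eq_zero]
    set D := K j - (l m j / l m m) • K m with hD
    have hKD : (K m)ᴴ * D = 0 := by
      rw [hD, Matrix.mul_sub, Matrix.mul_smul, hl, hl, smul_smul, div_mul_cancel₀ _ hm, sub_self]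
    have hcol : ∀ i, (fun s => D s i) = 0 := by
      intro i
      obtain ⟨φ, hφ, hφ'⟩ := hpure _ (isPureState_single i)
      have hv : ∑ k, vecMulVec (fun s => K k s i) (star fun s => K k s i) =
          vecMulVec φ (star φ) := by
        rw [← hφ']
        ext s t
        simp only [LinearMap.sum_apply, Matrix.sum_apply, conjMap_single_apply]
        rfl
      have hpar := exists_eq_smul_of_sum_vecMulVec (v := fun k s => K k s i) hφ hv
      obtain ⟨t, ht⟩ : ∃ t : ℂ, (fun s => K m s i) = t • φ := hpar m
      obtain ⟨u, hu⟩ : ∃ u : ℂ, (fun s => K j s i) = u • φ := hpar j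
      have hDφ : (fun s => D s i) = (u - l m j / l m m * t) • φ := by
        ext s
        have h1 : K m s i = t * φ s := congrFun ht s
        have h2 : K j s i = u * φ s := congrFun hu s
        have h3 : D s i = K j s i - l m j / l m m * K m s i := rfl
        change D s i = (u - l m j / l m m * t) * φ s
        rw [h3, h1, h2]
        ring
      have h1 : star (fun s => K m s i) ⬝ᵥ (fun s => D s i) = 0 := congrFun (congrFun hKD i) i
      rw [hDφ, ht, star_smul, smul_dotProduct, dotProduct_smul, hφ] at h1
      have ht0 : t ≠ 0 := by
        rintro rfl
        have h2 : star (fun s => K m s i) ⬝ᵥ (fun s => K m s i) = l m m := by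
          refine (congrFun (congrFun (hl m m) i) i).trans ?_
          simp
        rw [ht] at h2
        exact hm (by simpa using h2.symm)
      rw [hDφ]
      have : u - l m j / l m m * t = 0 := by simpa [ht0] using h1
      rw [this, zero_smul]
    ext s i
    exact congrFun (hcol i) s
  let q : Fin n → ℂ := fun j => l m j / l m m
  -- Proportional Kraus operators merge into one, with weight `p`, the sum of the `|q j|²`.
  let p : ℝ := ∑ j, Complex.normSq (q j)
  have hp : 0 ≤ p := Finset.sum_nonneg fun j _ => Complex.normSq_nonneg _
  have hpp : ((Real.sqrt p : ℝ) : ℂ) * ((Real.sqrt p : ℝ) : ℂ) = ∑ j, q j * star (q j) := by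
    rw [← Complex.ofReal_mul, Real.mul_self_sqrt hp]
    simp [p, Complex.mul_conj]
  have hpp' : star ((Real.sqrt p : ℝ) : ℂ) = ((Real.sqrt p : ℝ) : ℂ) := Complex.conj_ofReal _
  refine ⟨((Real.sqrt p : ℝ) : ℂ) • K m, ?_, ?_⟩
  · rw [conjTranspose_smul, hpp', Matrix.smul_mul, Matrix.mul_smul, smul_smul, hpp, Finset.sum_smul,
      ← hK]
    refine Finset.sum_congr rfl fun j _ => ?_
    conv_rhs => rw [hprop j]
    rw [conjTranspose_smul, Matrix.smul_mul, Matrix.mul_smul, smul_smul, mul_comm]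
  · refine LinearMap.ext fun ρ => ?_
    rw [LinearMap.sum_apply, conjMap_apply, conjTranspose_smul, hpp', Matrix.smul_mul,
      Matrix.mul_smul, Matrix.smul_mul, smul_smul, hpp, Finset.sum_smul]
    refine Finset.sum_congr rfl fun j _ => ?_
    conv_lhs => rw [hprop j]
    rw [conjMap_apply, conjTranspose_smul, Matrix.smul_mul,
      Matrix.mul_smul, Matrix.smul_mul, smul_smul, mul_comm]

end KnillLaflamme

/-! ### Complementary channels -/

section Duality

variable {a b c κ a' b' : Type*} [Fintype a] [DecidableEq a] [Fintype b] [DecidableEq b]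
  [Fintype c] [DecidableEq c] [Fintype κ] [Fintype a'] [DecidableEq a'] [Fintype b']
  [DecidableEq b']

theorem IsDensity.partialTrace {M : Matrix c c ℂ} (hM : IsDensity M) (e : c ≃ a × b) :
    IsDensity (partialTrace e M) := by
  constructor
  · have : QSS.partialTrace e M =
        ∑ k : b, M.submatrix (fun i => e.symm (i, k)) (fun i => e.symm (i, k)) := by
      ext i j
      simp [QSS.partialTrace, Matrix.sum_apply]
    rw [this]
    exact posSemidef_sum _ fun k _ => hM.1.submatrix _
  · rw [← hM.2, trace, trace, ← e.symm.sum_comp, Fintype.sum_prod_type]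
    rfl

theorem IsDensity.conjMap {ρ : Matrix a a ℂ} (hρ : IsDensity ρ) {V : Matrix b a ℂ}
    (hV : Vᴴ * V = 1) : IsDensity (conjMap V ρ) := by
  refine ⟨hρ.1.mul_mul_conjTranspose_same V, ?_⟩
  rw [conjMap_apply, Matrix.trace_mul_comm, ← Matrix.mul_assoc, hV, Matrix.one_mul, hρ.2]

/-- The Kraus operators `(1 ⊗ ⟨k|) V` of the channel `Tr_b (V · V*)`. -/
def sliceKraus (e : c ≃ a' × b) (V : Matrix c a ℂ) (k : b) : Matrix a' a ℂ :=
  Matrix.of fun i x => V (e.symm (i, k)) x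

theorem partialTrace_comp_conjMap (e : c ≃ a' × b) (V : Matrix c a ℂ) :
    (partialTrace e).comp (conjMap V) = ∑ k, conjMap (sliceKraus e V k) := by
  refine LinearMap.ext fun ρ => ?_
  ext i j
  simp [partialTrace, sliceKraus, LinearMap.sum_apply, Matrix.sum_apply, Matrix.mul_apply]

theorem sum_sliceKraus (e : c ≃ a' × b) {V : Matrix c a ℂ} :
    ∑ k, (sliceKraus e V k)ᴴ * sliceKraus e V k = Vᴴ * V := by
  ext x y
  simp only [Matrix.sum_apply, Matrix.mul_apply, conjTranspose_apply, sliceKraus, Matrix.of_apply]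
  rw [Finset.sum_comm, ← Fintype.sum_prod_type',
    ← e.symm.sum_comp (fun s => star (V s x) * V s y)]

theorem isReversible_partialTrace_comp_conjMap_iff [Nonempty a] (e : c ≃ a' × b)
    {V : Matrix c a ℂ} (hV : Vᴴ * V = 1) :
    IsReversible ((partialTrace e).comp (conjMap V)) {ρ | IsDensity ρ} ↔
      ∃ l : b → b → ℂ, ∀ i j, (sliceKraus e V i)ᴴ * sliceKraus e V j = l i j • 1 := by
  rw [partialTrace_comp_conjMap]
  refine ⟨fun h => h.knillLaflamme, fun ⟨l, hl⟩ => isReversible_of_knillLaflamme ?_ hl _⟩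
  rw [sum_sliceKraus, hV]

/-- The slices are taken along the factor that is kept, so they are Kraus operators of the
complementary channel. By `hent` their products list the values of the channel on matrix units;
being scalar means that the channel is the trace times a fixed matrix. -/
theorem isVanishing_partialTrace_comp_conjMap_iff [Nonempty a] (e : c ≃ b' × a')
    {V : Matrix c a ℂ} (hV : Vᴴ * V = 1) :
    IsVanishing ((partialTrace e).comp (conjMap V)) {ρ | IsDensity ρ} ↔
      ∃ l : b' → b' → ℂ, ∀ i j, (sliceKraus (e.trans (Equiv.prodComm _ _)) V i)ᴴ *
        sliceKraus (e.trans (Equiv.prodComm _ _)) V j = l i j • 1 := by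
  have hent : ∀ x y i j, ((sliceKraus (e.trans (Equiv.prodComm _ _)) V i)ᴴ *
      sliceKraus (e.trans (Equiv.prodComm _ _)) V j) x y =
        (partialTrace e).comp (conjMap V) (single y x 1) j i := by
    intro x y i j
    simp only [LinearMap.comp_apply, partialTrace, LinearMap.coe_mk, AddHom.coe_mk,
      Matrix.of_apply, conjMap_single_apply]
    simp [Matrix.mul_apply, sliceKraus, mul_comm]
  constructor
  · rintro ⟨ρ₀, -, h⟩
    have hE : (partialTrace e).comp (conjMap V) =
        (LinearMap.toSpanSingleton ℂ _ ρ₀).comp (traceLinearMap a ℂ ℂ) := by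
      refine ext_isPureState fun ρ hρ => ?_
      rw [h ρ hρ.isDensity]
      simp [hρ.isDensity.2]
    refine ⟨fun i j => ρ₀ j i, fun i j => ?_⟩
    ext x y
    rw [hent, hE]
    by_cases hxy : x = y
    · subst hxy
      simp
    · simp [hxy, trace_single_eq_of_ne _ _ _ (Ne.symm hxy)]
  · rintro ⟨l, hl⟩
    obtain ⟨x₀⟩ := ‹Nonempty a›
    refine ⟨_, ((isPureState_single x₀).isDensity.conjMap hV).partialTrace e, fun ρ hρ => ?_⟩
    have hE : (partialTrace e).comp (conjMap V) =
        (LinearMap.toSpanSingleton ℂ _ (Matrix.of fun j i => l i j)).comp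
          (traceLinearMap a ℂ ℂ) := by
      refine ext_single fun y x => ?_
      ext j i
      rw [← hent, hl]
      by_cases hxy : x = y
      · subst hxy
        simp
      · simp [hxy, trace_single_eq_of_ne _ _ _ (Ne.symm hxy)]
    change _ = (partialTrace e).comp (conjMap V) _
    rw [hE]
    simp [hρ.2]

/-- Complementarity: discarding the second factor is reversible if and only if discarding the
first factor is vanishing. -/
theorem isReversible_iff_isVanishing [Nonempty a] {V : Matrix c a ℂ} (hV : Vᴴ * V = 1)
    (e : c ≃ a' × b) (e' : c ≃ b' × κ) (f : b' ≃ b) (g : κ ≃ a')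
    (he : ∀ x, e x = (g (e' x).2, f (e' x).1)) :
    IsReversible ((partialTrace e).comp (conjMap V)) {ρ | IsDensity ρ} ↔
      IsVanishing ((partialTrace e').comp (conjMap V)) {ρ | IsDensity ρ} := by
  classical
  rw [isReversible_partialTrace_comp_conjMap_iff e hV,
    isVanishing_partialTrace_comp_conjMap_iff e' hV]
  -- Up to relabelling, both sides slice `V` along the same factor, so both conditions are the same
  -- Knill–Laflamme condition.
  have hsl : ∀ i, sliceKraus (e'.trans (Equiv.prodComm _ _)) V i =
      (sliceKraus e V (f i)).submatrix g id := by
    intro i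
    ext s x
    simp only [sliceKraus, Matrix.of_apply, submatrix_apply, id]
    congr 1
    rw [Equiv.eq_symm_apply, he]
    simp
  have hmul : ∀ i j, (sliceKraus (e'.trans (Equiv.prodComm _ _)) V i)ᴴ *
      sliceKraus (e'.trans (Equiv.prodComm _ _)) V j =
        (sliceKraus e V (f i))ᴴ * sliceKraus e V (f j) := by
    intro i j
    rw [hsl, hsl, conjTranspose_submatrix, submatrix_mul_equiv, submatrix_id_id]
  simp only [hmul]
  constructor
  · rintro ⟨l, hl⟩
    exact ⟨fun i j => l (f i) (f j), fun i j => hl _ _⟩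
  · rintro ⟨l, hl⟩
    exact ⟨fun i j => l (f.symm i) (f.symm j), fun i j => by simpa using hl (f.symm i) (f.symm j)⟩

end Duality

/-! ### Invariance under relabelling of the output basis -/

section Reindex

variable {a b b' : Type*} [Fintype a] [DecidableEq a] [Fintype b] [DecidableEq b]
  [Fintype b'] [DecidableEq b']

theorem IsReversible.of_submatrix {E : Matrix a a ℂ →ₗ[ℂ] Matrix b b ℂ}
    {E' : Matrix a a ℂ →ₗ[ℂ] Matrix b' b' ℂ} (f : b' ≃ b)
    (h : ∀ ρ, E' ρ = (E ρ).submatrix f f) {S : Set (Matrix a a ℂ)} (hE : IsReversible E S) :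
    IsReversible E' S := by
  obtain ⟨R, hR, hrec⟩ := hE
  refine ⟨R.comp (reindexLinearEquiv ℂ ℂ f f).toLinearMap, ⟨fun k M hM => ?_, fun M => ?_⟩,
    fun ρ hρ => ?_⟩
  · exact hR.completelyPositive k (M.submatrix (fun p => (p.1, f.symm p.2))
      (fun p => (p.1, f.symm p.2))) (hM.submatrix _)
  · rw [LinearMap.comp_apply, hR.tracePreserving]
    exact f.symm.sum_comp (fun i => M i i)
  · rw [LinearMap.comp_apply, h]
    simp [hrec ρ hρ]

theorem isReversible_submatrix_iff {E : Matrix a a ℂ →ₗ[ℂ] Matrix b b ℂ}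
    {E' : Matrix a a ℂ →ₗ[ℂ] Matrix b' b' ℂ} (f : b' ≃ b)
    (h : ∀ ρ, E' ρ = (E ρ).submatrix f f) {S : Set (Matrix a a ℂ)} :
    IsReversible E' S ↔ IsReversible E S :=
  ⟨fun hE => hE.of_submatrix f.symm fun ρ => by simp [h], fun hE => hE.of_submatrix f h⟩

theorem IsVanishing.of_submatrix {E : Matrix a a ℂ →ₗ[ℂ] Matrix b b ℂ}
    {E' : Matrix a a ℂ →ₗ[ℂ] Matrix b' b' ℂ} (f : b' ≃ b)
    (h : ∀ ρ, E' ρ = (E ρ).submatrix f f) {S : Set (Matrix a a ℂ)} (hE : IsVanishing E S) :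
    IsVanishing E' S := by
  obtain ⟨ρ₀, hρ₀, hS⟩ := hE
  refine ⟨ρ₀.submatrix f f, ⟨hρ₀.1.submatrix f, ?_⟩, fun ρ hρ => by rw [h, hS ρ hρ]⟩
  rw [← hρ₀.2]
  exact f.sum_comp (fun i => ρ₀ i i)

theorem isVanishing_submatrix_iff {E : Matrix a a ℂ →ₗ[ℂ] Matrix b b ℂ}
    {E' : Matrix a a ℂ →ₗ[ℂ] Matrix b' b' ℂ} (f : b' ≃ b)
    (h : ∀ ρ, E' ρ = (E ρ).submatrix f f) {S : Set (Matrix a a ℂ)} :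
    IsVanishing E' S ↔ IsVanishing E S :=
  ⟨fun hE => hE.of_submatrix f.symm fun ρ => by simp [h], fun hE => hE.of_submatrix f h⟩

end Reindex

/-! ### Shares, dilation and access structures -/

section Shares

variable {ι : Type*} [Fintype ι] [DecidableEq ι]

/-- The labels outside of the complement of `X` are the labels of `X`. -/
def notMemComplLabelEquiv (d : ι → ℕ) (X : Finset ι) :
    (∀ i : {i // ¬ i ∈ Xᶜ}, Fin (d i)) ≃ SubLabel d X where
  toFun x i := x ⟨i, by simp [i.2]⟩
  invFun x i := x ⟨i, by simpa using i.2⟩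
  left_inv _ := rfl
  right_inv _ := rfl

/-- The labels of the complement of `X` are the labels outside of `X`. -/
def complLabelEquiv (d : ι → ℕ) (X : Finset ι) :
    SubLabel d Xᶜ ≃ (∀ i : {i // ¬ i ∈ X}, Fin (d i)) where
  toFun x i := x ⟨i, Finset.mem_compl.mpr i.2⟩
  invFun x i := x ⟨i, Finset.mem_compl.mp i.2⟩
  left_inv _ := rfl
  right_inv _ := rfl

/-- In a pure state scheme, the qualified sets are the complements of the forbidden sets. -/
theorem IsPureScheme.isQualified_iff {h : ℕ} {d : ι → ℕ} (h0 : 0 < h) {W : Encoder h d}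
    (hW : IsPureScheme W) (X : Finset ι) : IsQualified W X ↔ IsForbidden W Xᶜ := by
  have : Nonempty (Fin h) := ⟨⟨0, h0⟩⟩
  obtain ⟨V, hV, rfl⟩ := exists_isometry_of_isPureStateChannel hW.1.1 hW.1.2 hW.2
  exact isReversible_iff_isVanishing hV _ _ (complLabelEquiv d X) (notMemComplLabelEquiv d X)
    fun x => rfl

/-- The labels of a set of shares do not change when a share is added. -/
def mapSomeLabelEquiv (d : ι → ℕ) (z : ℕ) (X : Finset ι) :
    SubLabel (addShare d z) (X.map Function.Embedding.some) ≃ SubLabel d X where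
  toFun x i := x ⟨some i, by simp [i.2]⟩
  invFun x o := match o with
    | ⟨some i, hi⟩ => x ⟨i, by simpa using hi⟩
    | ⟨none, hi⟩ => absurd hi (by simp)
  left_inv x := by
    funext ⟨o, ho⟩
    cases o with
    | none => exact absurd ho (by simp)
    | some i => rfl
  right_inv _ := rfl

/-- The labels outside of a set of old shares, when a share is added. -/
def notMemMapSomeLabelEquiv (d : ι → ℕ) (z : ℕ) (X : Finset ι) :
    (∀ o : {o // ¬ o ∈ X.map Function.Embedding.some}, Fin (addShare d z o)) ≃
      (∀ i : {i // ¬ i ∈ X}, Fin (d i)) × Fin z where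
  toFun x := (fun i => x ⟨some i, by simpa using i.2⟩, x ⟨none, by simp⟩)
  invFun x o := match o with
    | ⟨some i, hi⟩ => x.1 ⟨i, by simpa using hi⟩
    | ⟨none, _⟩ => x.2
  left_inv x := by
    funext ⟨o, ho⟩
    cases o with
    | none => rfl
    | some i => rfl
  right_inv _ := rfl

/-- Tracing out `Z` and then the old shares outside `X` is one trace over all of them; the
relabelling reconciles the two index types. -/
theorem restrict_map_some {h : ℕ} {d : ι → ℕ} {z : ℕ} (W : Encoder h (addShare d z))
    (X : Finset ι) (ρ : Matrix (Fin h) (Fin h) ℂ) :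
    restrict W (X.map Function.Embedding.some) ρ =
      (restrict (discardShare W) X ρ).submatrix (mapSomeLabelEquiv d z X)
        (mapSomeLabelEquiv d z X) := by
  ext s t
  simp only [restrict, discardShare, LinearMap.comp_apply, partialTrace, LinearMap.coe_mk,
    AddHom.coe_mk, Matrix.of_apply, submatrix_apply]
  rw [← Fintype.sum_prod_type', ← (notMemMapSomeLabelEquiv d z X).sum_comp]
  have hlab : ∀ (s : SubLabel (addShare d z) (X.map Function.Embedding.some)) k,
      (Equiv.piEquivPiSubtypeProd (fun o => o ∈ X.map Function.Embedding.some)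
        (fun o => Fin (addShare d z o))).symm (s, k) =
      (splitShare d z).symm ((Equiv.piEquivPiSubtypeProd (fun i => i ∈ X)
        (fun i => Fin (d i))).symm
          (mapSomeLabelEquiv d z X s, (notMemMapSomeLabelEquiv d z X k).1),
        (notMemMapSomeLabelEquiv d z X k).2) := by
    intro s k
    funext o
    cases o with
    | none =>
      simp [Equiv.piEquivPiSubtypeProd, splitShare, notMemMapSomeLabelEquiv]
    | some i =>
      by_cases hi : i ∈ X
      · simp [Equiv.piEquivPiSubtypeProd, splitShare, hi]
        rfl
      · simp [Equiv.piEquivPiSubtypeProd, splitShare, notMemMapSomeLabelEquiv, hi]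
  refine Finset.sum_congr rfl fun k _ => ?_
  rw [hlab, hlab]

theorem isQualified_map_some_iff {h : ℕ} {d : ι → ℕ} {z : ℕ} (W : Encoder h (addShare d z))
    (X : Finset ι) :
    IsQualified W (X.map Function.Embedding.some) ↔ IsQualified (discardShare W) X :=
  isReversible_submatrix_iff _ (restrict_map_some W X)

theorem isForbidden_map_some_iff {h : ℕ} {d : ι → ℕ} {z : ℕ} (W : Encoder h (addShare d z))
    (X : Finset ι) :
    IsForbidden W (X.map Function.Embedding.some) ↔ IsForbidden (discardShare W) X :=
  isVanishing_submatrix_iff _ (restrict_map_some W X)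

/-- Conjugation by an isometry is a pure state scheme. -/
theorem isPureScheme_conjMap {h : ℕ} {d : ι → ℕ} (h0 : 0 < h) {V : Matrix (Label d) (Fin h) ℂ}
    (hV : Vᴴ * V = 1) : IsPureScheme (conjMap V : Encoder h d) := by
  have : Nonempty (Fin h) := ⟨⟨0, h0⟩⟩
  have hs : (conjMap V : Encoder h d) = ∑ _i : Unit, conjMap V := by simp
  refine ⟨⟨?_, ?_⟩, ?_⟩
  · rw [hs]
    exact isQuantumOperation_kraus (by simpa using hV)
  · rw [hs]
    exact isReversible_of_knillLaflamme (l := fun _ _ => 1) (by simpa using hV)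
      (by simpa using hV) _
  · rintro ρ ⟨ψ, hψ, rfl⟩
    refine ⟨V *ᵥ ψ, ?_, ?_⟩
    · rw [star_mulVec, ← dotProduct_mulVec, mulVec_mulVec, hV, one_mulVec, hψ]
    · rw [conjMap_apply, mul_vecMulVec, vecMulVec_mul, star_mulVec]

/-- Stinespring dilation: a quantum operation is realized by an isometry into a larger space and
discarding the additional share. -/
theorem IsQuantumOperation.exists_isometry {h : ℕ} {d : ι → ℕ} {W : Encoder h d}
    (hW : IsQuantumOperation W) :
    ∃ (z : ℕ) (V : Matrix (Label (addShare d z)) (Fin h) ℂ), Vᴴ * V = 1 ∧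
      discardShare (conjMap V : Encoder h (addShare d z)) = W := by
  obtain ⟨n, K, rfl, hK⟩ := hW.exists_kraus
  -- The label of `Z` selects the Kraus operator, so slicing `V` along `Z` returns the `K k`.
  let V : Matrix (Label (addShare d n)) (Fin h) ℂ :=
    Matrix.of fun x i => K (splitShare d n x).2 (splitShare d n x).1 i
  have hsl : ∀ k, sliceKraus (splitShare d n) V k = K k := by
    intro k
    ext s i
    simp [sliceKraus, V]
  refine ⟨n, V, ?_, ?_⟩
  · rw [← sum_sliceKraus (splitShare d n)]
    simpa only [hsl] using hK
  · rw [discardShare, partialTrace_comp_conjMap]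
    simp only [hsl]

/-- The access structure on `N ∪ {Z}` of the pure state schemes that realize schemes with a given
access structure on `N` by discarding the share `Z`. -/
def AccessStructure.dilate (A : AccessStructure ι) : AccessStructure (Option ι) where
  forbidden := {Y | (none ∉ Y ∧ Y.eraseNone ∈ A.forbidden) ∨
    (none ∈ Y ∧ Yᶜ.eraseNone ∈ A.qualified)}
  intermediate := {Y | (none ∉ Y ∧ Y.eraseNone ∈ A.intermediate) ∨
    (none ∈ Y ∧ Yᶜ.eraseNone ∈ A.intermediate)}
  qualified := {Y | (none ∉ Y ∧ Y.eraseNone ∈ A.qualified) ∨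
    (none ∈ Y ∧ Yᶜ.eraseNone ∈ A.forbidden)}

theorem AccessStructure.ext' {A B : AccessStructure ι} (hf : A.forbidden = B.forbidden)
    (hi : A.intermediate = B.intermediate) (hq : A.qualified = B.qualified) : A = B := by
  cases A
  cases B
  simp_all

/-- Either `Y` or its complement avoids `Z` and is therefore visible after the discard; in the
second case complementarity swaps forbidden with qualified and so preserves intermediate. -/
theorem IsPureScheme.accessStructure_eq {h : ℕ} {d : ι → ℕ} {z : ℕ} (h0 : 0 < h)
    {W : Encoder h (addShare d z)} (hW : IsPureScheme W) :
    accessStructure W = (accessStructure (discardShare W)).dilate := by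
  have hmap : ∀ Y : Finset (Option ι), none ∉ Y →
      Y.eraseNone.map Function.Embedding.some = Y := fun Y hY => by
    rw [Finset.map_some_eraseNone, Finset.erase_eq_of_notMem hY]
  have hQ : ∀ Y : Finset (Option ι), none ∉ Y →
      (IsQualified (discardShare W) Y.eraseNone ↔ IsQualified W Y) := fun Y hY => by
    rw [← isQualified_map_some_iff, hmap Y hY]
  have hF : ∀ Y : Finset (Option ι), none ∉ Y →
      (IsForbidden (discardShare W) Y.eraseNone ↔ IsForbidden W Y) := fun Y hY => by
    rw [← isForbidden_map_some_iff, hmap Y hY]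
  have hd : ∀ Y, IsQualified W Y ↔ IsForbidden W Yᶜ := hW.isQualified_iff h0
  have hd' : ∀ Y, IsForbidden W Y ↔ IsQualified W Yᶜ := fun Y => by rw [hd, compl_compl]
  apply AccessStructure.ext' <;> ext Y <;> by_cases hY : none ∈ Y <;>
    simp only [accessStructure, AccessStructure.dilate, Set.mem_ofPred_eq, IsIntermediate, hY,
      not_true, not_false_iff, false_and, true_and, or_false, false_or]
  · rw [hQ _ (by simpa using hY), hd']
  · rw [hF _ hY]
  · rw [hQ _ (by simpa using hY), hF _ (by simpa using hY), ← hd, ← hd', and_comm]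
  · rw [hQ _ hY, hF _ hY]
  · rw [hF _ (by simpa using hY), hd]
  · rw [hQ _ hY]

end Shares

end QSS

theorem lemma1 {ι : Type*} [Fintype ι] [DecidableEq ι] :
    ∃ F : QSS.AccessStructure ι → QSS.AccessStructure (Option ι),
      ∀ (h : ℕ) (d : ι → ℕ) (W : QSS.Encoder h d), 0 < h → QSS.IsMixedScheme W →
        -- realization by discarding one share of a pure state scheme given by an isometry
        (∃ (z : ℕ) (V : Matrix (QSS.Label (QSS.addShare d z)) (Fin h) ℂ),
          V.conjTranspose * V = 1 ∧
          QSS.IsPureScheme (QSS.conjMap V : QSS.Encoder h (QSS.addShare d z)) ∧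
          QSS.discardShare (QSS.conjMap V : QSS.Encoder h (QSS.addShare d z)) = W) ∧
        -- every such pure state scheme has the access structure determined by that of `W`
        (∀ (z : ℕ) (W' : QSS.Encoder h (QSS.addShare d z)),
          QSS.IsPureScheme W' → QSS.discardShare W' = W →
          QSS.accessStructure W' = F (QSS.accessStructure W) ∧
          (∀ X : Finset ι,
            (QSS.IsQualified W' (X.map Function.Embedding.some) ↔ QSS.IsQualified W X) ∧
            (QSS.IsForbidden W' (X.map Function.Embedding.some) ↔ QSS.IsForbidden W X) ∧
            (QSS.IsIntermediate W' (X.map Function.Embedding.some) ↔ QSS.IsIntermediate W X)) ∧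
          (∀ Y : Finset (Option ι), none ∈ Y →
            (QSS.IsQualified W' Y ↔ QSS.IsForbidden W' Yᶜ) ∧
            (QSS.IsForbidden W' Y ↔ QSS.IsQualified W' Yᶜ) ∧
            (QSS.IsIntermediate W' Y ↔ QSS.IsIntermediate W' Yᶜ))) := by
  -- `dilate` is chosen before all dimensions and encoders, so it depends on the set of shares
  -- alone.
  refine ⟨QSS.AccessStructure.dilate, fun h d W h0 hW => ⟨?_, ?_⟩⟩
  · obtain ⟨z, V, hV, hWV⟩ := hW.1.1.exists_isometry
    exact ⟨z, V, hV, QSS.isPureScheme_conjMap h0 hV, hWV⟩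
  · rintro z W' hW' rfl
    have hd : ∀ Y, QSS.IsQualified W' Y ↔ QSS.IsForbidden W' Yᶜ := hW'.isQualified_iff h0
    have hd' : ∀ Y, QSS.IsForbidden W' Y ↔ QSS.IsQualified W' Yᶜ := fun Y => by
      rw [hd, compl_compl]
    refine ⟨hW'.accessStructure_eq h0, fun X => ?_, fun Y _ => ⟨hd Y, hd' Y, ?_⟩⟩
    · have hQ := QSS.isQualified_map_some_iff W' X
      have hF := QSS.isForbidden_map_some_iff W' X
      exact ⟨hQ, hF, and_congr (not_congr hQ) (not_congr hF)⟩
    · rw [QSS.IsIntermediate, QSS.IsIntermediate, ← hd, ← hd', and_comm]
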